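/- Let $L$ be a finite lattice. Then there exist a finite lattice $\tilde{L}$ and an injective lattice homomorphism $f \colon L \to \tilde{L}$ such that: (i) $f$ is congruence-preserving: for every congruence $\Theta$ of $L$ there is exactly one congruence $\overline{\Theta}$ of $\tilde{L}$ that extends $\Theta$ along $f$, that is, such that for all $x, y \in L$, $f(x) \equiv f(y) \pmod{\overline{\Theta}}$ if and only if $x \equiv y \pmod{\Theta}$; (ii) $\tilde{L}$ is regular: any congruence class of a congruence of $\tilde{L}$ determines the congruence, that is, if two congruences of $\tilde{L}$ have a congruence class in common, then they are equal. -/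

import Mathlib

universe u v

/-- A congruence `c` of a lattice is *regular* if any one of its classes determines it: a congruence
that has some class in common with `c` equals `c`. -/
def LatticeCon.IsRegular {α : Type u} [Lattice α] (c : LatticeCon α) : Prop :=
  ∀ A ∈ c.toSetoid.classes, ∀ d : LatticeCon α, A ∈ d.toSetoid.classes → d = c

/-- A lattice is *regular* if all its congruences are regular. -/
def IsRegularLattice (α : Type u) [Lattice α] : Prop :=
  ∀ c : LatticeCon α, c.IsRegular

/-- The restriction of a congruence of `β` along a lattice homomorphism `f : α → β`
(for the inclusion of a sublattice, this is the restriction to the sublattice). -/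
def LatticeCon.restrict {α : Type u} {β : Type v} [Lattice α] [Lattice β]
    (f : LatticeHom α β) (d : LatticeCon β) : LatticeCon α where
  toSetoid := d.toSetoid.comap f
  inf {w x y z} h₁ h₂ := by
    change d.r (f (w ⊓ y)) (f (x ⊓ z))
    rw [map_inf, map_inf]
    exact d.inf h₁ h₂
  sup {w x y z} h₁ h₂ := by
    change d.r (f (w ⊔ y)) (f (x ⊔ z))
    rw [map_sup, map_sup]
    exact d.sup h₁ h₂

/-- A lattice homomorphism `f : α → β` is a *congruence-preserving embedding* if it is injective and
every congruence of `α` has exactly one extension to `β`, that is, it is the restriction along `f`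
of exactly one congruence of `β`. -/
def IsCongruencePreservingEmbedding {α : Type u} {β : Type v} [Lattice α] [Lattice β]
    (f : LatticeHom α β) : Prop :=
  Function.Injective f ∧ ∀ c : LatticeCon α, ∃! d : LatticeCon β, d.restrict f = c

/-! The congruences of `L` form a finite distributive lattice, so by Birkhoff duality they
correspond to the lower sets of the poset `P` of meet-irreducible congruences: `c` corresponds to
`{p | ¬ c ≤ p}`, and `c` is the meet of the `p` outside this set. It suffices to embed `L` in a
lattice whose congruences are given by the same lower sets, each visible in every class. Each
quotient `L / p` is put inside a simple lattice `SimpleHull` with a separator that the image avoids.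
On the product of these hulls, the order `SepLE` ties a component equal to the separator to the
components above it. Collapsing the component at `q` then forces a collapse at every `p < q`, while
simplicity makes each collapse all or nothing. Hence the congruences are exactly the `coordCon H`
(`exists_eq_coordCon`). A class of `coordCon H` varies exactly in the coordinates in `H`, so it
determines `H`: this is regularity. The diagonal map `x ↦ (x / p)` avoids separators, so it is a
homomorphism; along it `coordCon H` restricts to the meet of the `p ∉ H`. -/

namespace LatticeCon

/-! ### Congruence lattices, their distributivity, and quotients. -/

variable {α : Type u} [Lattice α]

theorem toSetoid_injective : Function.Injective (toSetoid : LatticeCon α → Setoid α) := by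
  rintro ⟨r, _, _⟩ ⟨s, _, _⟩ h
  cases h
  rfl

theorem ext_iff_r {c d : LatticeCon α} : c = d ↔ ∀ x y, c.r x y ↔ d.r x y :=
  ⟨by rintro rfl; simp, fun h => toSetoid_injective (Setoid.ext h)⟩

theorem symm_r {c : LatticeCon α} {x y : α} (h : c.r x y) : c.r y x := c.symm' h

theorem trans_r {c : LatticeCon α} {x y z : α} (h : c.r x y) (h' : c.r y z) : c.r x z :=
  c.trans' h h'

instance : PartialOrder (LatticeCon α) := PartialOrder.lift toSetoid toSetoid_injective

theorem le_iff_r {c d : LatticeCon α} : c ≤ d ↔ ∀ x y, c.r x y → d.r x y := Iff.rfl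

omit [Lattice α] in
/-- A map that carries a relation into an equivalence relation also carries the equivalence relation
it generates. -/
theorem eqvGen_map {r : α → α → Prop} {s : Setoid α} (g : α → α)
    (h : ∀ x y, r x y → s.r (g x) (g y)) {x y : α} (hxy : Relation.EqvGen r x y) :
    s.r (g x) (g y) := by
  induction hxy with
  | rel x y h' => exact h x y h'
  | refl x => exact s.refl' _
  | symm x y _ ih => exact s.symm' ih
  | trans x y z _ _ ih ih' => exact s.trans' ih ih'

theorem setoid_sup_map (c d : LatticeCon α) {s : Setoid α} (g : α → α)
    (hc : ∀ x y, c.r x y → s.r (g x) (g y)) (hd : ∀ x y, d.r x y → s.r (g x) (g y)) {x y : α}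
    (hxy : (c.toSetoid ⊔ d.toSetoid).r x y) : s.r (g x) (g y) := by
  rw [Setoid.sup_eq_eqvGen] at hxy
  exact eqvGen_map g (fun x y h => h.elim (hc x y) (hd x y)) hxy

/-- The join of two lattice congruences. -/
def join (c d : LatticeCon α) : LatticeCon α where
  toSetoid := c.toSetoid ⊔ d.toSetoid
  inf {w x y z} h₁ h₂ := by
    have hc : ∀ x y, c.r x y → (c.toSetoid ⊔ d.toSetoid).r x y :=
      (le_sup_left : c.toSetoid ≤ c.toSetoid ⊔ d.toSetoid)
    have hd : ∀ x y, d.r x y → (c.toSetoid ⊔ d.toSetoid).r x y :=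
      (le_sup_right : d.toSetoid ≤ c.toSetoid ⊔ d.toSetoid)
    exact Setoid.trans' _
      (setoid_sup_map c d (· ⊓ y) (fun _ _ h => hc _ _ (c.inf h (c.refl' _)))
        (fun _ _ h => hd _ _ (d.inf h (d.refl' _))) h₁)
      (setoid_sup_map c d (x ⊓ ·) (fun _ _ h => hc _ _ (c.inf (c.refl' _) h))
        (fun _ _ h => hd _ _ (d.inf (d.refl' _) h)) h₂)
  sup {w x y z} h₁ h₂ := by
    have hc : ∀ x y, c.r x y → (c.toSetoid ⊔ d.toSetoid).r x y :=
      (le_sup_left : c.toSetoid ≤ c.toSetoid ⊔ d.toSetoid)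
    have hd : ∀ x y, d.r x y → (c.toSetoid ⊔ d.toSetoid).r x y :=
      (le_sup_right : d.toSetoid ≤ c.toSetoid ⊔ d.toSetoid)
    exact Setoid.trans' _
      (setoid_sup_map c d (· ⊔ y) (fun _ _ h => hc _ _ (c.sup h (c.refl' _)))
        (fun _ _ h => hd _ _ (d.sup h (d.refl' _))) h₁)
      (setoid_sup_map c d (x ⊔ ·) (fun _ _ h => hc _ _ (c.sup (c.refl' _) h))
        (fun _ _ h => hd _ _ (d.sup (d.refl' _) h)) h₂)

instance : Lattice (LatticeCon α) where
  sup := join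
  le_sup_left c d := (le_sup_left : c.toSetoid ≤ c.toSetoid ⊔ d.toSetoid)
  le_sup_right c d := (le_sup_right : d.toSetoid ≤ c.toSetoid ⊔ d.toSetoid)
  sup_le c d e h h' := (sup_le h h' : c.toSetoid ⊔ d.toSetoid ≤ e.toSetoid)
  inf c d :=
    { toSetoid := c.toSetoid ⊓ d.toSetoid
      inf := fun h h' => ⟨c.inf h.1 h'.1, d.inf h.2 h'.2⟩
      sup := fun h h' => ⟨c.sup h.1 h'.1, d.sup h.2 h'.2⟩ }
  inf_le_left _ _ _ _ h := h.1
  inf_le_right _ _ _ _ h := h.2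
  le_inf _ _ _ h h' _ _ hr := ⟨h hr, h' hr⟩

theorem inf_r {c d : LatticeCon α} {x y : α} : (c ⊓ d).r x y ↔ c.r x y ∧ d.r x y := Iff.rfl

instance : OrderTop (LatticeCon α) where
  top :=
    { toSetoid := ⊤
      inf := fun _ _ => trivial
      sup := fun _ _ => trivial }
  le_top _ _ _ _ := trivial

theorem top_r (x y : α) : (⊤ : LatticeCon α).r x y := trivial

/-- A congruence that relates two elements relates their median with any third element to them. -/
theorem median_r (c : LatticeCon α) {x y : α} (h : c.r x y) (t : α) :
    c.r (x ⊓ y ⊔ y ⊓ t ⊔ t ⊓ x) x := by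
  have h₁ : c.r (x ⊓ y ⊔ y ⊓ t ⊔ t ⊓ x) (x ⊓ x ⊔ x ⊓ t ⊔ t ⊓ x) :=
    c.sup (c.sup (c.inf (c.refl' _) (symm_r h)) (c.inf (symm_r h) (c.refl' _))) (c.refl' _)
  have h₂ : x ⊓ x ⊔ x ⊓ t ⊔ t ⊓ x = x := by
    rw [inf_idem, sup_inf_self, inf_comm, sup_inf_self]
  rwa [h₂] at h₁

/-- Congruence lattices of lattices are distributive. -/
instance : DistribLattice (LatticeCon α) :=
  DistribLattice.ofInfSupLe fun a b c => by
    rw [le_iff_r]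
    rintro x y ⟨ha, hbc⟩
    -- The median polynomial `t ↦ m(x, y, t)` fixes `x` and `y`, and all its values are `a`-related
    -- to `x`. It therefore carries a chain of `b`- and `c`-steps from `x` to `y` to a chain of `a ⊓
    -- b`- and `a ⊓ c`-steps.
    have key : ∀ d : LatticeCon α, a ⊓ d ≤ a ⊓ b ⊔ a ⊓ c → ∀ s t, d.r s t →
        (a ⊓ b ⊔ a ⊓ c).r (x ⊓ y ⊔ y ⊓ s ⊔ s ⊓ x) (x ⊓ y ⊔ y ⊓ t ⊔ t ⊓ x) :=
      fun d hd s t hst => le_iff_r.1 hd _ _ ⟨trans_r (median_r a ha s) (symm_r (median_r a ha t)),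
        d.sup (d.sup (d.refl' _) (d.inf (d.refl' _) hst)) (d.inf hst (d.refl' _))⟩
    have h := setoid_sup_map b c (s := (a ⊓ b ⊔ a ⊓ c).toSetoid)
      (fun t => x ⊓ y ⊔ y ⊓ t ⊔ t ⊓ x) (key b le_sup_left) (key c le_sup_right) hbc
    have hx : x ⊓ y ⊔ y ⊓ x ⊔ x ⊓ x = x := by
      rw [inf_comm y x, sup_idem, inf_idem, sup_comm, sup_inf_self]
    have hy : x ⊓ y ⊔ y ⊓ y ⊔ y ⊓ x = y := by
      rw [inf_idem, inf_comm x y, sup_comm (y ⊓ x) y, sup_inf_self, sup_inf_self]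
    simp only [hx, hy] at h
    exact h

instance [Finite α] : Finite (LatticeCon α) :=
  Finite.of_injective (fun c : LatticeCon α => c.r) fun _ _ h =>
    ext_iff_r.2 fun x y => by simp only at h; rw [h]

theorem finset_inf_r {ι : Type*} (s : Finset ι) (g : ι → LatticeCon α) {x y : α} :
    (s.inf g).r x y ↔ ∀ i ∈ s, (g i).r x y := by
  classical
  induction s using Finset.induction_on with
  | empty => exact iff_of_true (top_r x y) (by simp)
  | insert i s hi ih => rw [Finset.inf_insert, inf_r, ih]; simp

/-- The quotient of a lattice by a congruence. -/
def Quot (c : LatticeCon α) : Type u := Quotient c.toSetoid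

/-- The class of an element modulo a congruence. -/
def toQuot (c : LatticeCon α) (x : α) : c.Quot := Quotient.mk c.toSetoid x

theorem toQuot_eq {c : LatticeCon α} {x y : α} : c.toQuot x = c.toQuot y ↔ c.r x y :=
  Quotient.eq

theorem toQuot_surjective (c : LatticeCon α) : Function.Surjective c.toQuot :=
  Quotient.mk_surjective

instance (c : LatticeCon α) : Max c.Quot where
  max := Quotient.map₂ (· ⊔ ·) fun _ _ h _ _ h' => c.sup h h'

instance (c : LatticeCon α) : Min c.Quot where
  min := Quotient.map₂ (· ⊓ ·) fun _ _ h _ _ h' => c.inf h h'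

theorem toQuot_sup (c : LatticeCon α) (x y : α) : c.toQuot (x ⊔ y) = c.toQuot x ⊔ c.toQuot y := rfl

theorem toQuot_inf (c : LatticeCon α) (x y : α) : c.toQuot (x ⊓ y) = c.toQuot x ⊓ c.toQuot y := rfl

instance (c : LatticeCon α) : Lattice c.Quot :=
  Lattice.mk'
    (c.toQuot_surjective.forall₂.2 fun x y => by simp only [← toQuot_sup, sup_comm])
    (c.toQuot_surjective.forall₃.2 fun x y z => by simp only [← toQuot_sup, sup_assoc])
    (c.toQuot_surjective.forall₂.2 fun x y => by simp only [← toQuot_inf, inf_comm])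
    (c.toQuot_surjective.forall₃.2 fun x y z => by simp only [← toQuot_inf, inf_assoc])
    (c.toQuot_surjective.forall₂.2 fun x y => by simp only [← toQuot_inf, ← toQuot_sup, sup_inf_self])
    (c.toQuot_surjective.forall₂.2 fun x y => by simp only [← toQuot_inf, ← toQuot_sup, inf_sup_self])

instance [Finite α] (c : LatticeCon α) : Finite c.Quot := Finite.of_surjective _ c.toQuot_surjective

instance [Nonempty α] (c : LatticeCon α) : Nonempty c.Quot := .map c.toQuot ‹_›

end LatticeCon

/-- A *separator* of a bounded lattice is an element that is both an atom and a coatom. -/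
class HasSeparator (α : Type u) [Lattice α] [BoundedOrder α] where
  /-- the separator -/
  sep : α
  isAtom_sep : IsAtom sep
  isCoatom_sep : IsCoatom sep

open HasSeparator

instance (α : Type u) [Lattice α] [BoundedOrder α] [HasSeparator α] : HasSeparator αᵒᵈ where
  sep := OrderDual.toDual sep
  isAtom_sep := isCoatom_sep.dual
  isCoatom_sep := isAtom_sep.dual

/-- A lattice `α` enlarged by new bounds, two separators, and two copies `hi b a` of each `a : α`,
placed between `a` and the top. -/
inductive SimpleHull (α : Type u) : Type u
  | bot
  | top
  | sep (b : Bool)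
  | lo (a : α)
  | hi (b : Bool) (a : α)

/-! ### Embedding a lattice in a simple lattice with a separator. -/

namespace SimpleHull

variable {α : Type u}

instance [Finite α] : Finite (SimpleHull α) := by
  let g : Bool ⊕ Bool ⊕ α ⊕ (Bool × α) → SimpleHull α
    | .inl false => bot
    | .inl true => top
    | .inr (.inl b) => sep b
    | .inr (.inr (.inl a)) => lo a
    | .inr (.inr (.inr (b, a))) => hi b a
  refine Finite.of_surjective g ?_
  rintro (_ | _ | b | a | ⟨b, a⟩)
  exacts [⟨.inl false, rfl⟩, ⟨.inl true, rfl⟩, ⟨.inr (.inl b), rfl⟩, ⟨.inr (.inr (.inl a)), rfl⟩,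
    ⟨.inr (.inr (.inr (b, a))), rfl⟩]

variable [Lattice α]

/-- The order of `SimpleHull α`. -/
def Le : SimpleHull α → SimpleHull α → Prop
  | bot, _ => True
  | _, top => True
  | sep b, sep b' => b = b'
  | lo x, lo y => x ≤ y
  | lo x, hi _ y => x ≤ y
  | hi b x, hi b' y => b = b' ∧ x = y
  | _, _ => False

open Classical in
/-- The join of `SimpleHull α`. -/
noncomputable def join : SimpleHull α → SimpleHull α → SimpleHull α
  | bot, y => y
  | x, bot => x
  | sep b, sep b' => if b = b' then sep b else top
  | lo x, lo y => lo (x ⊔ y)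
  | lo x, hi b y => if x ≤ y then hi b y else top
  | hi b x, lo y => if y ≤ x then hi b x else top
  | hi b x, hi b' y => if b = b' ∧ x = y then hi b x else top
  | _, _ => top

open Classical in
/-- The meet of `SimpleHull α`. -/
noncomputable def meet : SimpleHull α → SimpleHull α → SimpleHull α
  | top, y => y
  | x, top => x
  | sep b, sep b' => if b = b' then sep b else bot
  | lo x, lo y => lo (x ⊓ y)
  | lo x, hi _ y => lo (x ⊓ y)
  | hi _ x, lo y => lo (x ⊓ y)
  | hi b x, hi b' y => if b = b' ∧ x = y then hi b x else lo (x ⊓ y)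
  | _, _ => bot

noncomputable instance : Lattice (SimpleHull α) where
  le := Le
  le_refl x := by cases x <;> simp [Le]
  le_trans x y z := by
    rcases x <;> rcases y <;> rcases z <;> simp only [Le] <;> grind
  le_antisymm x y := by
    rcases x <;> rcases y <;> simp only [Le] <;> grind
  sup := join
  inf := meet
  le_sup_left x y := by
    rcases x <;> rcases y <;> simp only [join] <;> (try split_ifs) <;> simp_all [Le]
  le_sup_right x y := by
    rcases x <;> rcases y <;> simp only [join] <;> (try split_ifs) <;> simp_all [Le]
  sup_le x y z := by
    rcases x <;> rcases y <;> rcases z <;> simp only [join] <;> (try split_ifs) <;>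
      simp only [Le] <;> grind [sup_le]
  inf_le_left x y := by
    rcases x <;> rcases y <;> simp only [meet] <;> (try split_ifs) <;> simp_all [Le]
  inf_le_right x y := by
    rcases x <;> rcases y <;> simp only [meet] <;> (try split_ifs) <;> simp_all [Le]
  le_inf x y z := by
    rcases x <;> rcases y <;> rcases z <;> simp only [meet] <;> (try split_ifs) <;>
      simp only [Le] <;> grind [le_inf]

instance : BoundedOrder (SimpleHull α) where
  bot := bot
  top := top
  bot_le _ := trivial
  le_top x := by cases x <;> trivial

theorem sup_def (x y : SimpleHull α) : x ⊔ y = join x y := rfl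

theorem inf_def (x y : SimpleHull α) : x ⊓ y = meet x y := rfl

theorem le_def (x y : SimpleHull α) : x ≤ y ↔ Le x y := Iff.rfl

theorem bot_def : (⊥ : SimpleHull α) = bot := rfl

theorem top_def : (⊤ : SimpleHull α) = top := rfl

instance : HasSeparator (SimpleHull α) where
  sep := sep true
  isAtom_sep := by
    refine ⟨nofun, fun x hx => ?_⟩
    rw [lt_iff_le_and_ne, le_def] at hx
    rcases x <;> simp_all [Le, bot_def]
  isCoatom_sep := by
    refine ⟨nofun, fun x hx => ?_⟩
    rw [lt_iff_le_and_ne, le_def] at hx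
    rcases x <;> simp_all [Le, top_def]

theorem exists_ne_sep :
    ∃ x : SimpleHull α, x ≠ ⊥ ∧ x ≠ ⊤ ∧ x ≠ HasSeparator.sep :=
  ⟨sep false, nofun, nofun, by simp [HasSeparator.sep]⟩

theorem lo_ne_sep (x : α) : lo x ≠ HasSeparator.sep := nofun

/-- The embedding of a lattice into its simple hull. -/
def loHom : LatticeHom α (SimpleHull α) where
  toFun := lo
  map_sup' _ _ := rfl
  map_inf' _ _ := rfl

variable (c : LatticeCon (SimpleHull α))

theorem bot_top_of_seps_top (h : ∀ b, c.r (sep b) top) : c.r ⊥ ⊤ := by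
  have := c.inf (h true) (h false)
  simpa [inf_def, meet, ← bot_def, ← top_def] using this

theorem bot_top_of_bot_seps (h : ∀ b, c.r bot (sep b)) : c.r ⊥ ⊤ := by
  have := c.sup (h true) (h false)
  simpa [sup_def, join, ← bot_def, ← top_def] using this

/-- Every `lo` or `hi` element is a complement of both `sep b`: meeting with these brings the
collapse down to both of them, and their join is the top. -/
theorem bot_top_of_lo_top {x : α} (h : c.r (lo x) top) : c.r ⊥ ⊤ :=
  bot_top_of_bot_seps c fun b => c.inf h (c.refl' (sep b))

theorem bot_top_of_hi_top {b : Bool} {x : α} (h : c.r (hi b x) top) : c.r ⊥ ⊤ :=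
  bot_top_of_bot_seps c fun b => c.inf h (c.refl' (sep b))

theorem bot_top_of_bot_lo {x : α} (h : c.r bot (lo x)) : c.r ⊥ ⊤ :=
  bot_top_of_seps_top c fun b => c.sup h (c.refl' (sep b))

theorem bot_top_of_bot_hi {b : Bool} {x : α} (h : c.r bot (hi b x)) : c.r ⊥ ⊤ :=
  bot_top_of_seps_top c fun b => c.sup h (c.refl' (sep b))

theorem bot_top_of_bot_sep [Nonempty α] {b : Bool} (h : c.r bot (sep b)) : c.r ⊥ ⊤ := by
  obtain ⟨x⟩ := ‹Nonempty α›
  exact bot_top_of_lo_top c (c.sup h (c.refl' (lo x)))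

theorem bot_top_of_sep_top [Nonempty α] {b : Bool} (h : c.r (sep b) top) : c.r ⊥ ⊤ := by
  obtain ⟨x⟩ := ‹Nonempty α›
  exact bot_top_of_bot_lo c (c.inf h (c.refl' (lo x)))

theorem bot_top_of_lo_hi {b : Bool} {x y : α} (h : c.r (lo x) (hi b y)) (hxy : x ≤ y) :
    c.r ⊥ ⊤ := by
  -- This is why there are two copies: the other copy of `y` lies above `lo x`, but its join with
  -- `hi b y` is the top.
  have := c.sup h (c.refl' (hi (!b) y))
  simp only [sup_def, join, hxy, if_true] at this
  exact bot_top_of_hi_top c (b := !b) (x := y) (by simpa using this)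

/-- `SimpleHull α` is simple. -/
theorem bot_top_of_ne [Nonempty α] {x y : SimpleHull α} (h : c.r x y) (hne : x ≠ y) :
    c.r ⊥ ⊤ := by
  wlog hlt : x < y generalizing x y
  · exact this (c.r_inf_sup_iff.2 h) (fun h => hne (inf_eq_sup.1 h)) (inf_lt_sup.2 hne)
  have hle : Le x y := hlt.le
  rcases x with _ | _ | b | x | ⟨b, x⟩ <;> rcases y with _ | _ | b' | y | ⟨b', y⟩ <;>
    simp only [Le] at hle <;> try exact (hne rfl).elim
  · exact h
  · exact bot_top_of_bot_sep c h
  · exact bot_top_of_bot_lo c h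
  · exact bot_top_of_bot_hi c h
  · exact bot_top_of_sep_top c h
  · exact (hne (by rw [hle])).elim
  · exact bot_top_of_lo_top c h
  -- The coatom `hi true x` lies above `lo x` but not above `lo y`.
  · have := c.sup h (c.refl' (hi true x))
    have hyx : ¬ y ≤ x := fun h' => hne (by rw [le_antisymm hle h'])
    simp only [sup_def, join, hyx, le_refl, if_true, if_false] at this
    exact bot_top_of_hi_top c this
  · exact bot_top_of_lo_hi c h hle
  · exact bot_top_of_hi_top c h
  · exact (hne (by rw [hle.1, hle.2])).elim

end SimpleHull

open HasSeparator

/-! ### Products of lattices with separators -/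

section SepProd

variable {P : Type u} [PartialOrder P] {S : P → Type v}
  [∀ p, Lattice (S p)] [∀ p, BoundedOrder (S p)] [∀ p, HasSeparator (S p)]

/-- The componentwise order, weakened so that where two comparable functions both take the separator
as their value, they agree above. -/
def SepLE (x y : ∀ p, S p) : Prop :=
  (∀ p, x p ≤ y p) ∧ ∀ p, x p = sep → y p = sep → ∀ q, p < q → x q = y q

theorem SepLE.refl (x : ∀ p, S p) : SepLE x x := ⟨fun _ => le_rfl, fun _ _ _ _ _ => rfl⟩

theorem SepLE.trans {x y z : ∀ p, S p} (hxy : SepLE x y) (hyz : SepLE y z) : SepLE x z := by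
  refine ⟨fun p => (hxy.1 p).trans (hyz.1 p), fun p hx hz q hq => ?_⟩
  have hy : y p = sep := le_antisymm ((hyz.1 p).trans_eq hz) (hx.symm.trans_le (hxy.1 p))
  exact (hxy.2 p hx hy q hq).trans (hyz.2 p hy hz q hq)

theorem SepLE.antisymm {x y : ∀ p, S p} (hxy : SepLE x y) (hyx : SepLE y x) : x = y :=
  funext fun p => le_antisymm (hxy.1 p) (hyx.1 p)

theorem sepLE_dual {x y : ∀ p, S p} :
    SepLE (S := fun p => (S p)ᵒᵈ) x y ↔ SepLE y x :=
  ⟨fun h => ⟨h.1, fun p hy hx q hq => (h.2 p hx hy q hq).symm⟩,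
    fun h => ⟨h.1, fun p hy hx q hq => (h.2 p hx hy q hq).symm⟩⟩

open Classical in
/-- The join with respect to `SepLE`: componentwise, except that a component equal to the separator
is raised to the top when this is forced by a component above. -/
noncomputable def sepSup [WellFoundedGT P] (x y : ∀ p, S p) (p : P) : S p :=
  if x p ⊔ y p = sep ∧ ((x p = sep ∧ ∃ q, ∃ _ : p < q, sepSup x y q ≠ x q) ∨
      (y p = sep ∧ ∃ q, ∃ _ : p < q, sepSup x y q ≠ y q))
  then ⊤ else x p ⊔ y p
termination_by (wellFounded_gt (α := P)).wrap p

variable [WellFoundedGT P]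

theorem le_sepSup (x y : ∀ p, S p) (p : P) : x p ⊔ y p ≤ sepSup x y p := by
  rw [sepSup]
  split_ifs
  exacts [le_top, le_rfl]

theorem sepSup_of_ne {x y : ∀ p, S p} {p : P} (h : x p ⊔ y p ≠ sep) :
    sepSup x y p = x p ⊔ y p := by
  rw [sepSup, if_neg fun h' => h h'.1]

theorem sepSup_of_eq_sep {x y : ∀ p, S p} {p : P} (h : sepSup x y p = sep) :
    x p ⊔ y p = sep ∧ (x p = sep → ∀ q, p < q → sepSup x y q = x q) ∧
      (y p = sep → ∀ q, p < q → sepSup x y q = y q) := by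
  rw [sepSup] at h
  split_ifs at h with h'
  · exact (isCoatom_sep.1 h.symm).elim
  · refine ⟨h, fun hx q hq => ?_, fun hy q hq => ?_⟩
    · by_contra hne
      exact h' ⟨h, .inl ⟨hx, q, hq, hne⟩⟩
    · by_contra hne
      exact h' ⟨h, .inr ⟨hy, q, hq, hne⟩⟩

theorem sepSup_comm (x y : ∀ p, S p) : sepSup x y = sepSup y x := by
  funext p
  induction p using (wellFounded_gt (α := P)).induction with
  | _ p ih =>
    have h₁ : ∀ z : ∀ p, S p, (∃ q, ∃ _ : p < q, sepSup x y q ≠ z q) ↔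
        ∃ q, ∃ _ : p < q, sepSup y x q ≠ z q := fun z =>
      exists_congr fun q => exists_congr fun hq => by rw [ih q hq]
    rw [sepSup, sepSup]
    classical
    exact if_congr (by rw [h₁, h₁, sup_comm (x p), or_comm]) rfl (sup_comm _ _)

theorem sepLE_sepSup_left (x y : ∀ p, S p) : SepLE x (sepSup x y) :=
  ⟨fun p => le_sup_left.trans (le_sepSup x y p),
    fun _ hx h q hq => ((sepSup_of_eq_sep h).2.1 hx q hq).symm⟩

theorem sepLE_sepSup_right (x y : ∀ p, S p) : SepLE y (sepSup x y) :=
  sepSup_comm y x ▸ sepLE_sepSup_left y x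

theorem sepSup_apply_le {x y z : ∀ p, S p} (hx : SepLE x z) (hy : SepLE y z) (p : P) :
    sepSup x y p ≤ z p := by
  induction p using (wellFounded_gt (α := P)).induction with
  | _ p ih =>
    -- If `z p` were still the separator, `z` would agree with `w` above `p`, and by induction so
    -- would the join, so nothing would force a raise.
    have key : ∀ w : ∀ p, S p, SepLE w z → SepLE w (sepSup x y) → w p = sep →
        (∃ q, ∃ _ : p < q, sepSup x y q ≠ w q) → ⊤ ≤ z p := by
      rintro w hw hw' hp ⟨q, hq, hne⟩
      rcases (hp.symm.trans_le (hw.1 p)).lt_or_eq with h | h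
      · exact (isCoatom_sep.2 _ h).ge
      · refine (hne (le_antisymm ?_ (hw'.1 q))).elim
        rw [hw.2 p hp h.symm q hq]
        exact ih q hq
    rw [sepSup]
    split_ifs with h
    · rcases h.2 with h' | h'
      exacts [key x hx (sepLE_sepSup_left x y) h'.1 h'.2,
        key y hy (sepLE_sepSup_right x y) h'.1 h'.2]
    · exact sup_le (hx.1 p) (hy.1 p)

theorem eq_sep_or_eq_sep_of_sup {α : Type*} [Lattice α] [BoundedOrder α] [HasSeparator α] {a b : α}
    (h : a ⊔ b = sep) : a = sep ∨ b = sep := by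
  rcases isAtom_sep.le_iff.1 (le_sup_left.trans_eq h) with ha | ha
  · right
    rwa [ha, bot_sup_eq] at h
  · exact .inl ha

theorem sepSup_sepLE {x y z : ∀ p, S p} (hx : SepLE x z) (hy : SepLE y z) :
    SepLE (sepSup x y) z := by
  refine ⟨sepSup_apply_le hx hy, fun p h hz q hq => ?_⟩
  obtain ⟨h₁, h₂, h₃⟩ := sepSup_of_eq_sep h
  rcases eq_sep_or_eq_sep_of_sup h₁ with h' | h'
  · rw [h₂ h' q hq, hx.2 p h' hz q hq]
  · rw [h₃ h' q hq, hy.2 p h' hz q hq]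

/-- The recursion only looks upwards; this is what makes collapsing a lower set of coordinates
compatible with the operations. -/
theorem sepSup_congr {x x' y y' : ∀ p, S p} {p : P} (hx : ∀ q, p ≤ q → x q = x' q)
    (hy : ∀ q, p ≤ q → y q = y' q) : sepSup x y p = sepSup x' y' p := by
  induction p using (wellFounded_gt (α := P)).induction with
  | _ p ih =>
    have h : ∀ q, p < q → sepSup x y q = sepSup x' y' q := fun q hq =>
      ih q hq (fun r hr => hx r (hq.le.trans hr)) (fun r hr => hy r (hq.le.trans hr))
    have h₁ : (∃ q, ∃ _ : p < q, sepSup x y q ≠ x q) ↔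
        ∃ q, ∃ _ : p < q, sepSup x' y' q ≠ x' q :=
      exists_congr fun q => exists_congr fun hq => by rw [h q hq, hx q hq.le]
    have h₂ : (∃ q, ∃ _ : p < q, sepSup x y q ≠ y q) ↔
        ∃ q, ∃ _ : p < q, sepSup x' y' q ≠ y' q :=
      exists_congr fun q => exists_congr fun hq => by rw [h q hq, hy q hq.le]
    rw [sepSup, sepSup]
    classical
    exact if_congr (by rw [h₁, h₂, hx p le_rfl, hy p le_rfl]) rfl
      (by rw [hx p le_rfl, hy p le_rfl])

end SepProd

/-- The product of a family of lattices with separators indexed by an ordered set, with the order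
`SepLE`. -/
@[ext]
structure SepProd {P : Type u} (S : P → Type v) : Type max u v where
  /-- the components -/
  val : ∀ p, S p

namespace SepProd

variable {P : Type u} {S : P → Type v}

instance [Finite P] [∀ p, Finite (S p)] : Finite (SepProd S) :=
  Finite.of_injective SepProd.val fun _ _ => SepProd.ext

section Single

variable [∀ p, Lattice (S p)] [∀ p, BoundedOrder (S p)]

open Classical in
/-- The element with a given component and all other components at the bottom. -/
noncomputable def single (q : P) (s : S q) : SepProd S := ⟨Function.update (fun _ => ⊥) q s⟩

@[simp]
theorem single_val_same (q : P) (s : S q) : (single q s).val q = s := by simp [single]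

theorem single_val_of_ne {q p : P} (h : p ≠ q) (s : S q) : (single q s).val p = ⊥ := by
  simp [single, h]

end Single

variable [PartialOrder P] [WellFoundedGT P]
  [∀ p, Lattice (S p)] [∀ p, BoundedOrder (S p)] [∀ p, HasSeparator (S p)]

noncomputable instance : Lattice (SepProd S) where
  le x y := SepLE x.val y.val
  le_refl x := .refl _
  le_trans _ _ _ := .trans
  le_antisymm _ _ h h' := SepProd.ext (h.antisymm h')
  sup x y := ⟨sepSup x.val y.val⟩
  le_sup_left _ _ := sepLE_sepSup_left _ _
  le_sup_right _ _ := sepLE_sepSup_right _ _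
  sup_le _ _ _ := sepSup_sepLE
  inf x y := ⟨sepSup (S := fun p => (S p)ᵒᵈ) x.val y.val⟩
  inf_le_left _ _ := sepLE_dual.1 (sepLE_sepSup_left (S := fun p => (S p)ᵒᵈ) _ _)
  inf_le_right _ _ := sepLE_dual.1 (sepLE_sepSup_right (S := fun p => (S p)ᵒᵈ) _ _)
  le_inf _ _ _ h h' := sepLE_dual.1 (sepSup_sepLE (sepLE_dual.2 h) (sepLE_dual.2 h'))

theorem le_def {x y : SepProd S} :
    x ≤ y ↔ (∀ p, x.val p ≤ y.val p) ∧
      ∀ p, x.val p = sep → y.val p = sep → ∀ q, p < q → x.val q = y.val q := Iff.rfl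

theorem val_le {x y : SepProd S} (h : x ≤ y) (p : P) : x.val p ≤ y.val p := h.1 p

theorem sup_val_of_ne {x y : SepProd S} {p : P} (h : x.val p ⊔ y.val p ≠ sep) :
    (x ⊔ y).val p = x.val p ⊔ y.val p :=
  sepSup_of_ne h

theorem inf_val_of_ne {x y : SepProd S} {p : P} (h : x.val p ⊓ y.val p ≠ sep) :
    (x ⊓ y).val p = x.val p ⊓ y.val p :=
  sepSup_of_ne (S := fun p => (S p)ᵒᵈ) h

theorem sup_val_congr {x x' y y' : SepProd S} {p : P} (hx : ∀ q, p ≤ q → x.val q = x'.val q)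
    (hy : ∀ q, p ≤ q → y.val q = y'.val q) : (x ⊔ y).val p = (x' ⊔ y').val p :=
  sepSup_congr hx hy

theorem inf_val_congr {x x' y y' : SepProd S} {p : P} (hx : ∀ q, p ≤ q → x.val q = x'.val q)
    (hy : ∀ q, p ≤ q → y.val q = y'.val q) : (x ⊓ y).val p = (x' ⊓ y').val p :=
  sepSup_congr (S := fun p => (S p)ᵒᵈ) hx hy

instance : OrderBot (SepProd S) where
  bot := ⟨fun _ => ⊥⟩
  bot_le _ := ⟨fun _ => bot_le, fun _ h => (isAtom_sep.1 h.symm).elim⟩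

theorem bot_val (p : P) : (⊥ : SepProd S).val p = ⊥ := rfl

/-- The congruence of `SepProd S` that collapses the components in a given lower set. -/
def coordCon (H : LowerSet P) : LatticeCon (SepProd S) where
  r x y := ∀ p, p ∉ H → x.val p = y.val p
  iseqv := ⟨fun _ _ _ => rfl, fun h p hp => (h p hp).symm,
    fun h h' p hp => (h p hp).trans (h' p hp)⟩
  inf h h' _ hp := inf_val_congr (fun q hq => h q fun hq' => hp (H.lower hq hq'))
    (fun q hq => h' q fun hq' => hp (H.lower hq hq'))
  sup h h' _ hp := sup_val_congr (fun q hq => h q fun hq' => hp (H.lower hq hq'))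
    (fun q hq => h' q fun hq' => hp (H.lower hq hq'))

theorem single_bot (q : P) : single q (⊥ : S q) = ⊥ :=
  SepProd.ext (by classical exact Function.update_eq_self q _)

theorem single_mono {q : P} {s t : S q} (h : s ≤ t) : single q s ≤ single q t := by
  refine le_def.2 ⟨fun p => ?_, fun p hs ht r hr => ?_⟩
  · rcases eq_or_ne p q with rfl | hp
    · simpa
    · rw [single_val_of_ne hp, single_val_of_ne hp]
  · have hp : p = q := by
      by_contra hp
      rw [single_val_of_ne hp] at hs
      exact isAtom_sep.1 hs.symm
    subst hp
    rw [single_val_of_ne hr.ne', single_val_of_ne hr.ne']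

theorem eq_single_of_le {q : P} {s : S q} {x : SepProd S} (h : x ≤ single q s) :
    x = single q (x.val q) := by
  refine SepProd.ext (funext fun p => ?_)
  rcases eq_or_ne p q with rfl | hp
  · simp
  · rw [single_val_of_ne hp]
    exact le_bot_iff.1 ((val_le h p).trans_eq (single_val_of_ne hp s))

/-- The embedding of a component as the elements supported there. -/
noncomputable def singleHom (q : P) : LatticeHom (S q) (SepProd S) where
  toFun := single q
  map_sup' s t := by
    have h : single q s ⊔ single q t ≤ single q (s ⊔ t) :=
      sup_le (single_mono le_sup_left) (single_mono le_sup_right)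
    refine le_antisymm (?_ : single q (s ⊔ t) ≤ _) h
    rw [eq_single_of_le h]
    refine single_mono (sup_le ?_ ?_)
    · simpa using val_le (le_sup_left : single q s ≤ single q s ⊔ single q t) q
    · simpa using val_le (le_sup_right : single q t ≤ single q s ⊔ single q t) q
  map_inf' s t := by
    have h : single q s ⊓ single q t ≤ single q s := inf_le_left
    rw [eq_single_of_le h]
    refine le_antisymm (?_ : single q (s ⊓ t) ≤ _) (single_mono (le_inf ?_ ?_))
    · rw [← eq_single_of_le h]
      exact le_inf (single_mono inf_le_left) (single_mono inf_le_right)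
    · simpa using val_le (inf_le_left : single q s ⊓ single q t ≤ single q s) q
    · simpa using val_le (inf_le_right : single q s ⊓ single q t ≤ single q t) q

section Congruences

variable (hS : ∀ (p : P) (c : LatticeCon (S p)) (x y : S p), c.r x y → x ≠ y → c.r ⊥ ⊤)
  (hsep : ∀ p, ∃ a : S p, a ≠ ⊥ ∧ a ≠ ⊤ ∧ a ≠ sep)

include hS hsep in
/-- A congruence that relates two elements with different components at `q` collapses the whole
component at `q`. -/
theorem bot_single_top (d : LatticeCon (SepProd S)) {q : P} {x y : SepProd S} (h : d.r x y)
    (hne : x.val q ≠ y.val q) : d.r ⊥ (single q ⊤) := by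
  wlog hle : x ≤ y generalizing x y
  · refine this (d.r_inf_sup_iff.2 h) (fun he => hne ?_) inf_le_sup
    exact le_antisymm
      ((val_le le_sup_left q).trans (he.ge.trans (val_le inf_le_right q)))
      ((val_le le_sup_right q).trans (he.ge.trans (val_le inf_le_left q)))
  wlog hy : y.val q ≠ sep generalizing x y
  · rw [not_not] at hy
    have hx : x.val q = ⊥ :=
      (isAtom_sep.le_iff.1 ((val_le hle q).trans_eq hy)).resolve_right (hy ▸ hne)
    obtain ⟨a, ha, ha', ha''⟩ := hsep q
    have hx' : (x ⊔ single q a).val q = a := by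
      rw [sup_val_of_ne] <;> simp [hx, ha'']
    have hy' : (y ⊔ single q a).val q = ⊤ := by
      have h₁ : (sep : S q) ≤ (y ⊔ single q a).val q := hy ▸ val_le le_sup_left q
      have h₂ : a ≤ (y ⊔ single q a).val q := by
        simpa using val_le (le_sup_right : single q a ≤ y ⊔ single q a) q
      refine isCoatom_sep.2 _ (h₁.lt_of_ne fun he => ?_)
      rw [← he] at h₂
      exact (isAtom_sep.le_iff.1 h₂).elim ha ha''
    exact this (d.sup h (d.refl' (single q a))) (by rwa [hx', hy']) (sup_le_sup_right hle _)
      (by rw [hy']; exact isCoatom_sep.1.symm)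
  -- Cutting down to the copy of `S q` keeps the two elements distinct, so simplicity of `S q`
  -- applies.
  have h₁ := d.inf h (d.refl' (single q ⊤))
  rw [eq_single_of_le (inf_le_right : x ⊓ single q ⊤ ≤ _),
    eq_single_of_le (inf_le_right : y ⊓ single q ⊤ ≤ _)] at h₁
  have hy' : (y ⊓ single q ⊤).val q = y.val q := by
    rw [inf_val_of_ne] <;> simp [hy]
  have hx' : (x ⊓ single q ⊤).val q ≤ x.val q := val_le inf_le_left q
  have h₂ := hS q (d.restrict (singleHom q)) _ _ h₁ fun he => hne
    (le_antisymm (val_le hle q) (by rwa [he, hy'] at hx'))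
  rw [← single_bot q]
  exact h₂

/-- The components that a congruence does not keep fixed. -/
def movedSet (d : LatticeCon (SepProd S)) : Set P := {q | ∃ x y, d.r x y ∧ x.val q ≠ y.val q}

include hS hsep in
theorem isLowerSet_movedSet (d : LatticeCon (SepProd S)) : IsLowerSet (movedSet d) := by
  rintro q p hpq ⟨x, y, h, hne⟩
  rcases hpq.eq_or_lt with rfl | hpq
  · exact ⟨x, y, h, hne⟩
  -- Joining `single p sep` with `single q ⊤` changes the component at `q`, above `p`, so the
  -- separator at `p` cannot survive.
  refine ⟨_, _, d.sup (d.refl' (single p sep)) (bot_single_top hS hsep d h hne), fun he => ?_⟩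
  rw [sup_bot_eq, single_val_same] at he
  have h₁ := (le_def.1 (le_sup_left : single p sep ≤ single p sep ⊔ single q (⊤ : S q))).2 p
    (single_val_same p sep) he.symm q hpq
  have h₂ := val_le (le_sup_right : single q (⊤ : S q) ≤ single p sep ⊔ single q ⊤) q
  rw [← h₁, single_val_of_ne hpq.ne', single_val_same] at h₂
  exact (isAtom_sep (α := S q)).1 (le_bot_iff.1 (le_top.trans h₂))

include hS hsep in
/-- Every congruence of `SepProd S` collapses the components in some lower set. -/
theorem exists_eq_coordCon [Finite P] (d : LatticeCon (SepProd S)) :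
    ∃ H : LowerSet P, d = coordCon H := by
  refine ⟨⟨movedSet d, isLowerSet_movedSet hS hsep d⟩, LatticeCon.ext_iff_r.2 fun x y =>
    ⟨fun h p hp => ?_, fun h => ?_⟩⟩
  · by_contra hne
    exact hp ⟨x, y, h, hne⟩
  set H : LowerSet P := ⟨movedSet d, isLowerSet_movedSet hS hsep d⟩
  have hs : ∀ q ∈ H, d.r ⊥ (single q ⊤) := by
    rintro q ⟨x, y, h, hne⟩
    exact bot_single_top hS hsep d h hne
  -- Joining with `t` sends every coordinate in `H` to the top. Working in `d ⊓ coordCon H` also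
  -- records that the other coordinates stay fixed.
  let t : SepProd S := (Set.toFinite (H : Set P)).toFinset.sup fun q => single q ⊤
  have ht : (d ⊓ coordCon H).r ⊥ t := by
    refine Finset.sup_induction (p := fun t => (d ⊓ coordCon H).r ⊥ t)
      ((d ⊓ coordCon H).refl' _) (fun a ha b hb => ?_) fun q hq => ?_
    · simpa using (d ⊓ coordCon H).sup ha hb
    · have hq' : q ∈ H := by simpa using hq
      refine ⟨hs q hq', fun p hp => ?_⟩
      rw [single_val_of_ne (by rintro rfl; exact hp hq'), bot_val]
  have hle : ∀ q ∈ H, single q ⊤ ≤ t := fun q hq =>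
    Finset.le_sup (f := fun q => single q (⊤ : S q)) (by simpa using hq)
  have htop : ∀ z : SepProd S, ∀ q ∈ H, (z ⊔ t).val q = ⊤ := fun z q hq =>
    top_le_iff.1 ((single_val_same q ⊤).symm.trans_le (val_le ((hle q hq).trans le_sup_right) q))
  have hz : ∀ z, (d ⊓ coordCon H).r z (z ⊔ t) := fun z => by
    simpa using (d ⊓ coordCon H).sup ((d ⊓ coordCon H).refl' z) ht
  have hxy : x ⊔ t = y ⊔ t := by
    refine SepProd.ext (funext fun p => ?_)
    by_cases hp : p ∈ H
    · rw [htop x p hp, htop y p hp]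
    · exact ((hz x).2 p hp).symm.trans ((h p hp).trans ((hz y).2 p hp))
  have hx := (hz x).1
  rw [hxy] at hx
  exact LatticeCon.trans_r hx (LatticeCon.symm_r (hz y).1)

/-- Changing one coordinate in `H` stays within the class, so that coordinate must also be free for
`H'`. -/
theorem coordCon_le_of_class {H H' : LowerSet P} [∀ p, Nontrivial (S p)] {A : Set (SepProd S)}
    (h : A ∈ (coordCon (S := S) H).toSetoid.classes)
    (h' : A ∈ (coordCon (S := S) H').toSetoid.classes) : H ≤ H' := by
  classical
  obtain ⟨x, rfl⟩ := h
  obtain ⟨y, hy⟩ := h'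
  intro q hq
  by_contra hq'
  obtain ⟨s, hs⟩ := exists_ne (x.val q)
  have h₁ : (coordCon H').r x y := by
    have : x ∈ {z | (coordCon (S := S) H).toSetoid z x} := (coordCon H).refl' x
    rw [hy] at this
    exact this
  have h₂ : (coordCon H').r ⟨Function.update x.val q s⟩ y := by
    have : (⟨Function.update x.val q s⟩ : SepProd S) ∈
        {z | (coordCon (S := S) H).toSetoid z x} := fun p hp => by
      have : p ≠ q := by rintro rfl; exact hp hq
      simp [this]
    rw [hy] at this
    exact this
  have h₃ := LatticeCon.trans_r h₂ (LatticeCon.symm_r h₁) q hq'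
  simp only [Function.update_self] at h₃
  exact hs h₃

include hS hsep in
theorem isRegularLattice [Finite P] : IsRegularLattice (SepProd S) := by
  have (p : P) : Nontrivial (S p) := ⟨_, _, (isAtom_sep (α := S p)).1⟩
  intro c A hc d hd
  obtain ⟨H, rfl⟩ := exists_eq_coordCon hS hsep c
  obtain ⟨H', rfl⟩ := exists_eq_coordCon hS hsep d
  rw [le_antisymm (coordCon_le_of_class hc hd) (coordCon_le_of_class hd hc)]

end Congruences

/-- A family of homomorphisms that avoid the separators is a homomorphism to the product. -/
def pi {L : Type*} [Lattice L] (g : ∀ p, LatticeHom L (S p)) (hg : ∀ p x, g p x ≠ sep) :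
    LatticeHom L (SepProd S) where
  toFun x := ⟨fun p => g p x⟩
  map_sup' x y := SepProd.ext <| funext fun p => by
    rw [sup_val_of_ne] <;> simp only [← map_sup]
    exact hg p _
  map_inf' x y := SepProd.ext <| funext fun p => by
    rw [inf_val_of_ne] <;> simp only [← map_inf]
    exact hg p _

end SepProd

/-- A congruence of a finite lattice is the meet of the meet-irreducible congruences above it. -/
theorem LatticeCon.r_iff_forall_infIrred {L : Type u} [Lattice L] [Finite L] (c : LatticeCon L)
    (x y : L) : c.r x y ↔ ∀ p : LatticeCon L, InfIrred p → c ≤ p → p.r x y := by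
  refine ⟨fun h p _ hp => hp h, fun h => ?_⟩
  obtain ⟨s, hs, hs'⟩ := exists_infIrred_decomposition c
  rw [← hs, finset_inf_r]
  intro p hp
  exact h p (hs' hp) (hs ▸ Finset.inf_le hp)

/-! ### The diagonal embedding and the comparison of congruences. -/

theorem theoremT (L : Type u) [Lattice L] [Finite L] :
    ∃ (M : Type u) (_ : Lattice M) (_ : Finite M) (f : LatticeHom L M),
      IsCongruencePreservingEmbedding f ∧ IsRegularLattice M := by
  classical
  let P := {p : LatticeCon L // InfIrred p}
  have := Fintype.ofFinite P
  let S : P → Type u := fun p => SimpleHull p.1.Quot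
  -- On an empty lattice the only congruence is `⊤`, which is not meet-irreducible. Nonemptiness is
  -- needed for the hulls to be simple.
  have hne (p : P) : Nonempty L := by
    by_contra h
    rw [not_nonempty_iff] at h
    exact p.2.ne_top (LatticeCon.ext_iff_r.2 fun x => h.elim x)
  have hS (p : P) (c : LatticeCon (S p)) (x y : S p) (h : c.r x y) (hxy : x ≠ y) : c.r ⊥ ⊤ :=
    have := hne p
    SimpleHull.bot_top_of_ne c h hxy
  have hsep (p : P) : ∃ a : S p, a ≠ ⊥ ∧ a ≠ ⊤ ∧ a ≠ sep := SimpleHull.exists_ne_sep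
  let g (p : P) : LatticeHom L (S p) := SimpleHull.loHom.comp
    ⟨⟨p.1.toQuot, p.1.toQuot_sup⟩, p.1.toQuot_inf⟩
  have hg (p : P) (x y : L) : g p x = g p y ↔ p.1.r x y :=
    ⟨fun h => LatticeCon.toQuot_eq.1 (SimpleHull.lo.inj h),
      fun h => congrArg SimpleHull.lo (LatticeCon.toQuot_eq.2 h)⟩
  let f : LatticeHom L (SepProd S) := SepProd.pi g fun p x => SimpleHull.lo_ne_sep _
  have hf (H : LowerSet P) (x y : L) :
      ((SepProd.coordCon H).restrict f).r x y ↔ ∀ p, p ∉ H → p.1.r x y :=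
    forall₂_congr fun p _ => hg p x y
  refine ⟨SepProd S, inferInstance, inferInstance, f, ⟨fun x y hxy => ?_, fun c => ?_⟩,
    SepProd.isRegularLattice hS hsep⟩
  · let eqCon : LatticeCon L :=
      ⟨⊥, by rintro _ _ _ _ rfl rfl; rfl, by rintro _ _ _ _ rfl rfl; rfl⟩
    refine (eqCon.r_iff_forall_infIrred x y).2 fun p hp _ => (hg ⟨p, hp⟩ x y).1 ?_
    exact congrFun (congrArg SepProd.val hxy) ⟨p, hp⟩
  · let H : LowerSet P := ⟨{p | ¬ c ≤ p.1}, fun q p hpq hq h => hq (h.trans hpq)⟩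
    refine ⟨SepProd.coordCon H, LatticeCon.ext_iff_r.2 fun x y => ?_, fun d hd => ?_⟩
    · rw [hf, c.r_iff_forall_infIrred]
      exact ⟨fun h p hp hcp => h ⟨p, hp⟩ (not_not.2 hcp),
        fun h p hp => h p.1 p.2 (not_not.1 hp)⟩
    · obtain ⟨H', rfl⟩ := SepProd.exists_eq_coordCon hS hsep d
      congr 1
      ext p
      refine not_iff_not.1 ⟨fun hp => ?_, fun hp => ?_⟩
      · refine not_not.2 (LatticeCon.le_iff_r.2 fun x y hxy => ?_)
        rw [← hd, hf] at hxy
        exact hxy p hp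
      · have hcp : c ≤ p.1 := not_not.1 hp
        -- The meet of the `q ∉ H'` lies below `p`. By distributivity `p` is meet-prime, so some
        -- such `q` is below `p`, and then `p ∉ H'`.
        have hc : (Finset.univ.filter fun q : P => q ∉ H').inf Subtype.val ≤ p.1 := by
          refine le_trans (LatticeCon.le_iff_r.2 fun x y hxy => ?_) hcp
          rw [LatticeCon.finset_inf_r] at hxy
          rw [← hd, hf]
          exact fun q hq => hxy q (by simpa using hq)
        obtain ⟨q, hq, hqp⟩ := (infPrime_iff_infIrred.2 p.2).finset_inf_le.1 hc
        exact fun hp' => (Finset.mem_filter.1 hq).2 (H'.lower hqp hp')
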